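/- For $n\ge 1$ and $\lambda\in\mathbb{C}$ let $J_n(\lambda)$ be the $n\times n$ Jordan cell with $\lambda$ on the diagonal and $1$ on the first superdiagonal, write $\backsim$ for similarity of complex square matrices and $\oplus$ for block-diagonal direct sum. For positive integers $p,q$ and complex matrices $A=(A_{ij})_{0\le i,j\le p-1}$, $B=(B_{ij})_{0\le i,j\le q-1}$ let $$\rho_{p,q}(A\otimes B)=\sum_{i_1,j_1=0}^{p-1}\ \sum_{i_2,j_2=0}^{q-1}A_{i_1j_1}B_{i_2j_2}\,E_{\,i_1+p\,i_2,\;j_1+p\,j_2},$$ where the $E_{I,J}$, $0\le I,J\le pq-1$, are the $pq\times pq$ matrix units (this is the Kronecker product of $A$ and $B$, up to ordering of the basis). **Theorem.** Let $p,q$ be positive integers and $a,b\in\mathbb{C}$. 1. If $ab\neq 0$, then $\displaystyle \rho_{p,q}(J_p(a)\otimes J_q(b))\backsim\bigoplus_{k=1}^{\min\{p,q\}}J_{p+q-2k+1}(ab).$ 2. If $a\neq 0$, then $\displaystyle \rho_{p,q}(J_p(a)\otimes J_q(0))\backsim\bigoplus_{k=1}^{p}J_q(0).$ 3. If $b\neq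 0$, then $\displaystyle \rho_{p,q}(J_p(0)\otimes J_q(b))\backsim\bigoplus_{k=1}^{q}J_p(0).$ 4. $\displaystyle \rho_{p,q}(J_p(0)\otimes J_q(0))\backsim\Bigl(\bigoplus_{k=1}^{\min\{p,q\}-1}\bigl(J_k(0)\oplus J_k(0)\bigr)\Bigr)\oplus\bigoplus_{k=1}^{|p-q|+1}J_{\min\{p,q\}}(0).$ -/

import Mathlib

open scoped Kronecker

/-- The Jordan cell `J_n(a)` of size `n` with eigenvalue `a`: `a` on the diagonal and `1` on the
first superdiagonal. -/
def jordanCell (n : ℕ) (a : ℂ) : Matrix (Fin n) (Fin n) ℂ :=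
  Matrix.of fun i j => if i = j then a else if (i : ℕ) + 1 = (j : ℕ) then 1 else 0

/-- The position `I = i₁ + p i₂` in `{0, …, p q - 1}` of the pair `(i₁, i₂)`. -/
def tensorIndex (p q : ℕ) (i : Fin p × Fin q) : Fin (p * q) :=
  ⟨(i.1 : ℕ) + p * (i.2 : ℕ), by
    have h1 := i.1.isLt
    have h2 : p * ((i.2 : ℕ) + 1) ≤ p * q := Nat.mul_le_mul_left p i.2.isLt
    rw [Nat.mul_add, Nat.mul_one] at h2
    omega⟩

/-- The tensor product map `ρ_{p,q}(T) = ∑ T_{i₁,j₁,i₂,j₂} E_{I,J}`, with `I = i₁ + p i₂` and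
`J = j₁ + p j₂`. A tensor in `Mat(p) ⊗ Mat(q)` is identified with the matrix of its coefficients
`T_{(i₁,i₂),(j₁,j₂)}`; the one of `A ⊗ B` is `A i₁ j₁ * B i₂ j₂`, that is `A ⊗ₖ B`. -/
def tensorProductMap (p q : ℕ) (T : Matrix (Fin p × Fin q) (Fin p × Fin q) ℂ) :
    Matrix (Fin (p * q)) (Fin (p * q)) ℂ :=
  ∑ i : Fin p × Fin q, ∑ j : Fin p × Fin q,
    Matrix.single (tensorIndex p q i) (tensorIndex p q j) (T i j)

/-- Similarity `D = U C U⁻¹` of complex square matrices. The index sets may be different types of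
the same size; they are then identified by a bijection. -/
def MatSimilar {m n : Type*} [Fintype n] [DecidableEq n]
    (C : Matrix m m ℂ) (D : Matrix n n ℂ) : Prop :=
  ∃ (e : m ≃ n) (U : Matrix n n ℂ), IsUnit U ∧ D = U * Matrix.reindex e e C * U⁻¹

/-- The direct sum `C ⊕ D` of two square matrices. -/
def matDirectSum {m n : Type*} (C : Matrix m m ℂ) (D : Matrix n n ℂ) :
    Matrix (m ⊕ n) (m ⊕ n) ℂ :=
  Matrix.fromBlocks C 0 0 D

/-!
For `a ≠ 0`, conjugation by the block-diagonal matrix of the powers `1, A, A², …` of `A = J_p(a)`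
carries `A ⊗ J_q(b) = bA ⊗ 1 + A ⊗ J_q(0)` to the Kronecker sum `bA ⊗ 1 + 1 ⊗ J_q(0)`. For `b = 0`
this is a sum of copies of `J_q(0)`. For `b ≠ 0` it is `ab` plus a Kronecker sum of nilpotent cells
which, after the scalar `b` is conjugated away in the same manner, is
`J_p(0) ⊗ 1 + 1 ⊗ J_q(0)`. That matrix is the lowering operator of `sl₂` on the tensor product of
the irreducible representations of dimensions `p` and `q`, and its Jordan form is the
Clebsch–Gordan decomposition: each primitive vector of weight `n` generates a Jordan chain of
length `n + 1`.
Finally, `J_p(0) ⊗ J_q(0)` moves the standard basis vectors down the diagonals of a `p × q`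
rectangle.
-/

/-- Similarity of square matrices over possibly different index types: `P * C = D * P` for some
rectangular `P` with a two-sided inverse. In contrast to `MatSimilar`, no bijection between the
index types is chosen, so that conjugations, changes of basis and permutations of indices
compose. -/
def IsSimilar {R m n : Type*} [CommRing R] [Fintype m] [Fintype n] [DecidableEq m] [DecidableEq n]
    (C : Matrix m m R) (D : Matrix n n R) : Prop :=
  ∃ (P : Matrix n m R) (Q : Matrix m n R), P * Q = 1 ∧ Q * P = 1 ∧ P * C = D * P

/-- The Kronecker sum `A ⊗ 1 + 1 ⊗ B`: the action of a pair of operators on a tensor product by the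
Leibniz rule. -/
def kroneckerSum {R m n : Type*} [CommRing R] [DecidableEq m] [DecidableEq n]
    (A : Matrix m m R) (B : Matrix n n R) : Matrix (m × n) (m × n) R :=
  A ⊗ₖ 1 + 1 ⊗ₖ B

namespace IsSimilar

variable {R l m n : Type*} [CommRing R] [Fintype l] [Fintype m] [Fintype n]
  [DecidableEq l] [DecidableEq m] [DecidableEq n]

theorem trans {B : Matrix l l R} {C : Matrix m m R} {D : Matrix n n R}
    (hBC : IsSimilar B C) (hCD : IsSimilar C D) : IsSimilar B D := by
  obtain ⟨P, P', hPP', hP'P, hP⟩ := hBC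
  obtain ⟨Q, Q', hQQ', hQ'Q, hQ⟩ := hCD
  refine ⟨Q * P, P' * Q', ?_, ?_, ?_⟩
  · rw [Matrix.mul_assoc, ← Matrix.mul_assoc P, hPP', Matrix.one_mul, hQQ']
  · rw [Matrix.mul_assoc, ← Matrix.mul_assoc Q', hQ'Q, Matrix.one_mul, hP'P]
  · rw [Matrix.mul_assoc, hP, ← Matrix.mul_assoc, hQ, Matrix.mul_assoc]

theorem of_isUnit {C D P : Matrix m m R} (hP : IsUnit P) (h : P * C = D * P) : IsSimilar C D := by
  obtain ⟨u, rfl⟩ := hP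
  exact ⟨u, ↑u⁻¹, u.mul_inv, u.inv_mul, h⟩

theorem submatrix (C : Matrix m m R) (e : n ≃ m) : IsSimilar C (C.submatrix e e) := by
  refine ⟨(1 : Matrix m m R).submatrix e id, (1 : Matrix m m R).submatrix id e, ?_, ?_, ?_⟩
  · rw [← Matrix.submatrix_mul _ _ e id e Function.bijective_id, Matrix.one_mul,
      Matrix.submatrix_one_equiv]
  · rw [Matrix.submatrix_mul_equiv, Matrix.one_mul, Matrix.submatrix_id_id]
  · rw [Matrix.submatrix_mul_equiv, Matrix.mul_one, ← Matrix.submatrix_id_id C,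
      ← Matrix.submatrix_mul _ _ e id id Function.bijective_id, Matrix.one_mul,
      Matrix.submatrix_id_id]

theorem toMatrix (C : Matrix m m R) (b : Module.Basis n R (m → R)) :
    IsSimilar C (LinearMap.toMatrix b b (Matrix.toLin' C)) := by
  refine ⟨b.toMatrix (Pi.basisFun R m), (Pi.basisFun R m).toMatrix b,
    Module.Basis.toMatrix_mul_toMatrix_flip _ _, Module.Basis.toMatrix_mul_toMatrix_flip _ _, ?_⟩
  conv_lhs => rw [← LinearMap.toMatrix'_toLin' C, ← LinearMap.toMatrix_eq_toMatrix']
  rw [basis_toMatrix_mul_linearMap_toMatrix, linearMap_toMatrix_mul_basis_toMatrix]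

theorem smul_one_add (c : R) {C : Matrix m m R} {D : Matrix n n R} (h : IsSimilar C D) :
    IsSimilar (c • 1 + C) (c • 1 + D) := by
  obtain ⟨P, Q, hPQ, hQP, hP⟩ := h
  exact ⟨P, Q, hPQ, hQP, by simp [Matrix.add_mul, Matrix.mul_add, hP]⟩

theorem kronecker_comm (A : Matrix m m R) (B : Matrix n n R) : IsSimilar (A ⊗ₖ B) (B ⊗ₖ A) := by
  convert submatrix (A ⊗ₖ B) (Equiv.prodComm n m) using 1
  ext i j
  exact mul_comm _ _

theorem kroneckerSum_comm (A : Matrix m m R) (B : Matrix n n R) :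
    IsSimilar (kroneckerSum A B) (kroneckerSum B A) := by
  convert submatrix (kroneckerSum A B) (Equiv.prodComm n m) using 1
  ext ⟨i, i'⟩ ⟨j, j'⟩
  simp [kroneckerSum, mul_comm, add_comm]

theorem one_kronecker (A : Matrix m m R) :
    IsSimilar ((1 : Matrix n n R) ⊗ₖ A) (Matrix.blockDiagonal' fun _ : n => A) := by
  convert submatrix ((1 : Matrix n n R) ⊗ₖ A) (Equiv.sigmaEquivProd n m) using 1
  ext ⟨k, i⟩ ⟨l, j⟩
  simp [Matrix.blockDiagonal'_apply, Matrix.one_apply]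

theorem matSimilar {C : Matrix m m ℂ} {D : Matrix n n ℂ} (h : IsSimilar C D) : MatSimilar C D := by
  obtain ⟨P, Q, hPQ, hQP, hP⟩ := h
  have e : m ≃ n := Fintype.equivOfCardEq (Matrix.square_of_invertible Q P hQP hPQ)
  have hU : P.submatrix id e.symm * Q.submatrix e.symm id = 1 := by
    rw [Matrix.submatrix_mul_equiv, hPQ, Matrix.submatrix_id_id]
  refine ⟨e, P.submatrix id e.symm, IsUnit.of_mul_eq_one _ hU, ?_⟩
  rw [Matrix.inv_eq_right_inv hU, Matrix.reindex_apply, Matrix.submatrix_mul_equiv,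
    Matrix.submatrix_mul_equiv, hP, Matrix.mul_assoc, hPQ, Matrix.mul_one, Matrix.submatrix_id_id]

end IsSimilar

theorem tensorIndex_bijective (p q : ℕ) : Function.Bijective (tensorIndex p q) := by
  have h : tensorIndex p q = finCongr (Nat.mul_comm q p) ∘ finProdFinEquiv ∘ Prod.swap := by
    ext x
    simp [tensorIndex, finProdFinEquiv]
  rw [h]
  exact (finCongr _).bijective.comp (finProdFinEquiv.bijective.comp Prod.swap_bijective)

theorem tensorProductMap_apply_tensorIndex (p q : ℕ)
    (T : Matrix (Fin p × Fin q) (Fin p × Fin q) ℂ) (i j : Fin p × Fin q) :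
    tensorProductMap p q T (tensorIndex p q i) (tensorIndex p q j) = T i j := by
  simp [tensorProductMap, Matrix.sum_apply, Matrix.single_apply,
    (tensorIndex_bijective p q).1.eq_iff, ite_and]

theorem IsSimilar.tensorProductMap_matSimilar {p q : ℕ} {n : Type*} [Fintype n] [DecidableEq n]
    {T : Matrix (Fin p × Fin q) (Fin p × Fin q) ℂ} {D : Matrix n n ℂ} (h : IsSimilar T D) :
    MatSimilar (tensorProductMap p q T) D := by
  have hT := submatrix (tensorProductMap p q T) (Equiv.ofBijective _ (tensorIndex_bijective p q))
  have hsub : (tensorProductMap p q T).submatrix (tensorIndex p q) (tensorIndex p q) = T :=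
    Matrix.ext (tensorProductMap_apply_tensorIndex p q T)
  rw [Equiv.coe_ofBijective, hsub] at hT
  exact (hT.trans h).matSimilar

/-! ### Jordan cells -/

theorem jordanCell_zero_apply {n : ℕ} (i j : Fin n) :
    jordanCell n 0 i j = if (i : ℕ) + 1 = j then 1 else 0 := by
  rcases eq_or_ne i j with rfl | h
  · simp [jordanCell]
  · simp [jordanCell, h]

theorem jordanCell_eq_smul_one_add (n : ℕ) (a : ℂ) :
    jordanCell n a = a • 1 + jordanCell n 0 := by
  ext i j
  rcases eq_or_ne i j with rfl | h
  · simp [jordanCell]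
  · simp [jordanCell, h]

theorem isUnit_jordanCell (n : ℕ) {a : ℂ} (ha : a ≠ 0) : IsUnit (jordanCell n a) := by
  have htri : (jordanCell n a).IsUpperTriangular := fun i j hij => by
    have hij : j < i := hij
    rw [jordanCell, Matrix.of_apply, if_neg hij.ne', if_neg (by omega)]
  rw [Matrix.isUnit_iff_isUnit_det, Matrix.det_of_isUpperTriangular htri]
  simp [jordanCell, ha]

theorem blockDiagonal'_jordanCell_zero_apply {κ : Type*} [DecidableEq κ] (n : κ → ℕ)
    (x y : Σ k, Fin (n k)) :
    Matrix.blockDiagonal' (fun k => jordanCell (n k) 0) x y =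
      if x.1 = y.1 ∧ (x.2 : ℕ) + 1 = y.2 then 1 else 0 := by
  obtain ⟨k, i⟩ := x
  obtain ⟨l, j⟩ := y
  rcases eq_or_ne k l with rfl | h
  · simp [jordanCell_zero_apply]
  · simp [Matrix.blockDiagonal'_apply_ne, h]

theorem blockDiagonal'_jordanCell {κ : Type*} [DecidableEq κ] (n : κ → ℕ) (a : ℂ) :
    Matrix.blockDiagonal' (fun k => jordanCell (n k) a) =
      a • 1 + Matrix.blockDiagonal' fun k => jordanCell (n k) 0 := by
  rw [← Matrix.blockDiagonal'_one, ← Matrix.blockDiagonal'_smul, ← Matrix.blockDiagonal'_add]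
  exact congrArg _ (funext fun k => jordanCell_eq_smul_one_add (n k) a)

theorem toMatrix_eq_blockDiagonal'_jordanCell_zero {κ V : Type*} [Fintype κ] [DecidableEq κ]
    [AddCommGroup V] [Module ℂ V] {n : κ → ℕ} (b : Module.Basis (Σ k, Fin (n k)) ℂ V)
    (T : Module.End ℂ V)
    (hT : ∀ k (j : Fin (n k)), T (b ⟨k, j⟩) =
      if 0 < (j : ℕ) then b ⟨k, ⟨j - 1, by omega⟩⟩ else 0) :
    LinearMap.toMatrix b b T = Matrix.blockDiagonal' fun k => jordanCell (n k) 0 := by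
  ext ⟨k, i⟩ ⟨l, j⟩
  rw [LinearMap.toMatrix_apply, hT, blockDiagonal'_jordanCell_zero_apply]
  rcases eq_or_ne k l with rfl | h
  · split_ifs <;> simp_all [Finsupp.single_apply, Fin.ext_iff] <;> omega
  · split_ifs <;> simp_all [eq_comm]

/-! ### Conjugation by block-diagonal powers -/

theorem blockDiagonal_mul_kronecker_apply {R m n : Type*} [CommRing R] [Fintype m]
    [Fintype n] [DecidableEq n] (M : n → Matrix m m R) (A : Matrix m m R) (C : Matrix n n R)
    (x y : m × n) :
    (Matrix.blockDiagonal M * A ⊗ₖ C) x y = (M x.2 * A) x.1 y.1 * C x.2 y.2 := by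
  simp [Matrix.mul_apply, Fintype.sum_prod_type, Matrix.blockDiagonal_apply, Finset.sum_mul,
    mul_assoc]

theorem kronecker_mul_blockDiagonal_apply {R m n : Type*} [CommRing R] [Fintype m]
    [Fintype n] [DecidableEq n] (M : n → Matrix m m R) (A : Matrix m m R) (C : Matrix n n R)
    (x y : m × n) :
    (A ⊗ₖ C * Matrix.blockDiagonal M) x y = C x.2 y.2 * (A * M y.2) x.1 y.1 := by
  simp [Matrix.mul_apply, Fintype.sum_prod_type, Matrix.blockDiagonal_apply, Finset.mul_sum,
    mul_assoc, mul_left_comm]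

theorem isUnit_blockDiagonal {R m n : Type*} [CommRing R] [Fintype m] [Fintype n] [DecidableEq m]
    [DecidableEq n] {M : n → Matrix m m R} (hM : ∀ k, IsUnit (M k)) :
    IsUnit (Matrix.blockDiagonal M) :=
  (Pi.isUnit_iff.2 hM).map (Matrix.blockDiagonalRingHom m n R)

theorem IsSimilar.kronecker_jordanCell_zero_add {m : Type*} [Fintype m] [DecidableEq m] (n : ℕ)
    {A Y : Matrix m m ℂ} (hA : IsUnit A) (hAY : Commute A Y) :
    IsSimilar (A ⊗ₖ jordanCell n 0 + Y ⊗ₖ 1) (kroneckerSum Y (jordanCell n 0)) := by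
  refine of_isUnit (isUnit_blockDiagonal fun k : Fin n => hA.pow (k : ℕ)) ?_
  ext x y
  simp only [kroneckerSum, Matrix.mul_add, Matrix.add_mul, Matrix.add_apply,
    blockDiagonal_mul_kronecker_apply, kronecker_mul_blockDiagonal_apply, ← pow_succ,
    Matrix.one_mul]
  rw [add_comm]
  congr 1
  · rcases eq_or_ne x.2 y.2 with h | h
    · rw [h, (hAY.pow_left _).eq, mul_comm]
    · simp [h]
  · by_cases h : (x.2 : ℕ) + 1 = y.2
    · rw [h, mul_comm]
    · simp [jordanCell_zero_apply, h]

theorem IsSimilar.kronecker_jordanCell_zero {m : Type*} [Fintype m] [DecidableEq m] (n : ℕ)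
    {A : Matrix m m ℂ} (hA : IsUnit A) :
    IsSimilar (A ⊗ₖ jordanCell n 0) (Matrix.blockDiagonal' fun _ : m => jordanCell n 0) := by
  have h := kronecker_jordanCell_zero_add n hA (Commute.zero_right A)
  simp only [kroneckerSum, Matrix.zero_kronecker, add_zero, zero_add] at h
  exact h.trans (one_kronecker _)

theorem IsSimilar.jordanCell_kronecker_jordanCell (p q : ℕ) {a b : ℂ} (ha : a ≠ 0) (hb : b ≠ 0) :
    IsSimilar (jordanCell p a ⊗ₖ jordanCell q b)
      ((a * b) • 1 + kroneckerSum (jordanCell p 0) (jordanCell q 0)) := by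
  have hsplit : jordanCell p a ⊗ₖ jordanCell q b =
      jordanCell p a ⊗ₖ jordanCell q 0 + (b • jordanCell p a) ⊗ₖ 1 := by
    rw [jordanCell_eq_smul_one_add q b, Matrix.kronecker_add, Matrix.kronecker_smul,
      Matrix.smul_kronecker, add_comm]
  have hscalar : kroneckerSum (b • jordanCell p a) (jordanCell q 0) =
      (a * b) • 1 + kroneckerSum (b • jordanCell p 0) (jordanCell q 0) := by
    rw [jordanCell_eq_smul_one_add p a, kroneckerSum, kroneckerSum, smul_add, smul_smul, mul_comm,
      Matrix.add_kronecker, Matrix.smul_kronecker, Matrix.one_kronecker_one, add_assoc]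
  have hrescale : IsSimilar (kroneckerSum (b • jordanCell p 0) (jordanCell q 0))
      (kroneckerSum (jordanCell p 0) (jordanCell q 0)) := by
    have hunit : IsUnit (b • 1 : Matrix (Fin q) (Fin q) ℂ) := isUnit_one.smul (Units.mk0 b hb)
    have h := kronecker_jordanCell_zero_add p hunit
      ((Commute.one_left (jordanCell q 0)).smul_left b)
    rw [Matrix.smul_kronecker, ← Matrix.kronecker_smul, add_comm] at h
    exact ((kroneckerSum_comm _ _).trans h).trans (kroneckerSum_comm _ _)
  rw [hsplit]
  refine (kronecker_jordanCell_zero_add q (isUnit_jordanCell p ha)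
    ((Commute.refl _).smul_right b)).trans ?_
  rw [hscalar]
  exact hrescale.smul_one_add (a * b)

/-! ### Primitive vectors and Jordan chains -/

theorem linearIndependent_of_jordanChains {K V κ : Type*} [CommRing K] [AddCommGroup V]
    [Module K V] (N : Module.End K V) {n : κ → ℕ} {w : (Σ k, Fin (n k)) → V} {z : κ → V}
    (hz : LinearIndependent K z) (hw : ∀ x, (N ^ (x.2 : ℕ)) (w x) = z x.1)
    (hN : ∀ k, N (z k) = 0) : LinearIndependent K w := by
  classical
  rw [linearIndependent_iff']
  intro s g hg
  by_contra! ⟨x, hx, hgx⟩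
  obtain ⟨y, hy, hmax⟩ := (s.filter (g · ≠ 0)).exists_max_image (fun x => (x.2 : ℕ))
    ⟨x, Finset.mem_filter.2 ⟨hx, hgx⟩⟩
  obtain ⟨hys, hgy⟩ := Finset.mem_filter.1 hy
  have hterm : ∀ x ∈ s, (N ^ (y.2 : ℕ)) (g x • w x) =
      if (x.2 : ℕ) = y.2 then g x • z x.1 else 0 := by
    intro x hx
    rw [map_smul]
    rcases lt_trichotomy (x.2 : ℕ) y.2 with h | h | h
    · obtain ⟨d, hd⟩ := Nat.exists_eq_add_of_lt h
      rw [if_neg h.ne, hd, add_assoc, add_comm, pow_add, Module.End.mul_apply, hw, pow_succ,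
        Module.End.mul_apply, hN, map_zero, smul_zero]
    · rw [if_pos h, ← h, hw]
    · have hgx : g x = 0 := by
        by_contra hgx
        exact (hmax x (Finset.mem_filter.2 ⟨hx, hgx⟩)).not_gt h
      rw [if_neg h.ne', hgx, zero_smul]
  have hends : ∑ x ∈ s with (x.2 : ℕ) = y.2, g x • z x.1 = 0 := by
    rw [Finset.sum_filter, ← Finset.sum_congr rfl hterm, ← map_sum, hg, map_zero]
  have hinj : Set.InjOn Sigma.fst (s.filter fun x => (x.2 : ℕ) = y.2 : Set (Σ k, Fin (n k))) := by
    rintro ⟨k, i⟩ hi ⟨l, j⟩ hj (rfl : k = l)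
    obtain rfl : i = j :=
      Fin.ext ((Finset.mem_filter.1 hi).2.trans (Finset.mem_filter.1 hj).2.symm)
    rfl
  have hindep : LinearIndepOn K (fun x : Σ k, Fin (n k) => z x.1)
      (s.filter fun x => (x.2 : ℕ) = y.2 : Set (Σ k, Fin (n k))) := hz.comp _ hinj.injective
  exact hgy (linearIndepOn_finset_iff.1 hindep g hends y (Finset.mem_filter.2 ⟨hys, rfl⟩))

section Sl2

open LieModule

theorem linearIndependent_pow_toEnd_f {K L M κ : Type*} [Field K] [CharZero K] [LieRing L]
    [LieAlgebra K L] [AddCommGroup M] [Module K M] [LieRingModule L M] [LieModule K L M]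
    [FiniteDimensional K M] {h e f : L} {t : IsSl2Triple h e f} {n : κ → ℕ}
    (hn : Function.Injective n) {v : κ → M} (P : ∀ k, t.HasPrimitiveVectorWith (v k) (n k : K)) :
    LinearIndependent K fun x : Σ k, Fin (n k + 1) => (toEnd K L M f ^ (n x.1 - x.2)) (v x.1) := by
  have hends : LinearIndependent K fun k => (toEnd K L M f ^ n k) (v k) := by
    refine Module.End.eigenvectors_linearIndependent' (toEnd K L M h) (fun k => -(n k : K))
      (fun k l hkl => hn (Nat.cast_injective (neg_injective hkl))) _ fun k => ⟨?_, ?_⟩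
    · rw [Module.End.mem_eigenspace_iff, toEnd_apply_apply, (P k).lie_h_pow_toEnd_f]
      congr 1
      ring
    · exact (P k).pow_toEnd_f_ne_zero_of_eq_nat rfl le_rfl
  refine linearIndependent_of_jordanChains (toEnd K L M f) hends (fun x => ?_) fun k => ?_
  · rw [← Module.End.mul_apply, ← pow_add, Nat.add_sub_cancel' (Nat.lt_succ_iff.1 x.2.2)]
  · rw [← Module.End.mul_apply, ← pow_succ']
    exact (P k).pow_toEnd_f_eq_zero_of_eq_nat rfl

theorem exists_basis_toMatrix_toEnd_f {L M κ : Type*} [Fintype κ] [DecidableEq κ] [LieRing L]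
    [LieAlgebra ℂ L] [AddCommGroup M] [Module ℂ M] [LieRingModule L M] [LieModule ℂ L M]
    [FiniteDimensional ℂ M] {h e f : L} {t : IsSl2Triple h e f} {n : κ → ℕ}
    (hn : Function.Injective n) {v : κ → M} (P : ∀ k, t.HasPrimitiveVectorWith (v k) (n k : ℂ))
    (hdim : ∑ k, (n k + 1) = Module.finrank ℂ M) :
    ∃ b : Module.Basis (Σ k, Fin (n k + 1)) ℂ M, LinearMap.toMatrix b b (toEnd ℂ L M f) =
      Matrix.blockDiagonal' fun k => jordanCell (n k + 1) 0 := by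
  refine ⟨basisOfLinearIndependentOfCardEqFinrank' _ (linearIndependent_pow_toEnd_f hn P)
    (by simpa using hdim), toMatrix_eq_blockDiagonal'_jordanCell_zero _ _ fun k j => ?_⟩
  simp only [coe_basisOfLinearIndependentOfCardEqFinrank']
  rw [← Module.End.mul_apply, ← pow_succ']
  split_ifs with hj
  · congr 2
    omega
  · rw [Nat.eq_zero_of_not_pos hj]
    exact (P k).pow_toEnd_f_eq_zero_of_eq_nat rfl

attribute [local instance] LieRing.ofAssociativeRing

theorem IsSimilar.of_hasPrimitiveVectorWith {m κ : Type*} [Fintype m] [DecidableEq m] [Fintype κ]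
    [DecidableEq κ] {H E F : Matrix m m ℂ} {t : IsSl2Triple H E F} {n : κ → ℕ}
    (hn : Function.Injective n) {v : κ → m → ℂ}
    (P : ∀ k, t.HasPrimitiveVectorWith (v k) (n k : ℂ)) (hcard : ∑ k, (n k + 1) = Fintype.card m) :
    IsSimilar F (Matrix.blockDiagonal' fun k => jordanCell (n k + 1) 0) := by
  obtain ⟨b, hb⟩ := exists_basis_toMatrix_toEnd_f hn P
    (hcard.trans (Module.finrank_fintype_fun_eq_card ℂ).symm)
  rw [← hb]
  exact toMatrix F b

/-! ### The tensor product of two irreducible representations of `sl₂` -/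

/-- The raising operator of the irreducible representation of `sl₂` of dimension `n`, in the basis
in which the lowering operator is `J_n(0)`. -/
def raisingCell (n : ℕ) : Matrix (Fin n) (Fin n) ℂ :=
  Matrix.of fun i j => if (j : ℕ) + 1 = i then (i : ℂ) * (n - i) else 0

/-- The weights of the irreducible representation of `sl₂` of dimension `n`, in the basis in which
the lowering operator is `J_n(0)`; they increase along the diagonal. -/
def weightCell (n : ℕ) : Matrix (Fin n) (Fin n) ℂ :=
  Matrix.diagonal fun i => 2 * (i : ℂ) - (n - 1)

theorem jordanCell_zero_mulVec {n : ℕ} (g : Fin n → ℂ) (i : Fin n) :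
    (jordanCell n 0).mulVec g i = if h : (i : ℕ) + 1 < n then g ⟨i + 1, h⟩ else 0 := by
  simp only [Matrix.mulVec, dotProduct, jordanCell_zero_apply, ite_mul, one_mul, zero_mul]
  split_ifs with h
  · rw [Finset.sum_eq_single_of_mem ⟨i + 1, h⟩ (Finset.mem_univ _), if_pos rfl]
    exact fun j _ hj => if_neg fun h' => hj (Fin.ext h'.symm)
  · exact Finset.sum_eq_zero fun j _ => if_neg (by omega)

theorem raisingCell_mulVec {n : ℕ} (g : Fin n → ℂ) (i : Fin n) :
    (raisingCell n).mulVec g i =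
      if 0 < (i : ℕ) then (i : ℂ) * (n - i) * g ⟨i - 1, by omega⟩ else 0 := by
  simp only [Matrix.mulVec, dotProduct, raisingCell, Matrix.of_apply, ite_mul, zero_mul]
  split_ifs with h
  · rw [Finset.sum_eq_single_of_mem ⟨i - 1, by omega⟩ (Finset.mem_univ _),
      if_pos (Nat.sub_add_cancel h)]
    exact fun j _ hj => if_neg fun h' => hj (Fin.ext (Nat.eq_sub_of_add_eq h'))
  · exact Finset.sum_eq_zero fun j _ => if_neg (by omega)

theorem raisingCell_mul_jordanCell_zero (n : ℕ) :
    raisingCell n * jordanCell n 0 = Matrix.diagonal fun i : Fin n => (i : ℂ) * (n - i) := by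
  ext i j
  change (raisingCell n).mulVec (fun k => jordanCell n 0 k j) i = _
  rw [raisingCell_mulVec, Matrix.diagonal_apply]
  simp only [jordanCell_zero_apply, Fin.ext_iff]
  rcases Nat.eq_zero_or_pos i with hi | hi
  · simp [hi]
  · simp [hi, Nat.sub_add_cancel hi]

theorem jordanCell_zero_mul_raisingCell (n : ℕ) :
    jordanCell n 0 * raisingCell n =
      Matrix.diagonal fun i : Fin n => ((i : ℂ) + 1) * (n - (i + 1)) := by
  ext i j
  change (jordanCell n 0).mulVec (fun k => raisingCell n k j) i = _
  rw [jordanCell_zero_mulVec, Matrix.diagonal_apply]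
  rcases (Nat.succ_le_iff.2 i.2).lt_or_eq with hi | hi
  · simp [raisingCell, hi, Fin.ext_iff, eq_comm]
  · have hn : (n : ℂ) = i + 1 := by exact_mod_cast hi.symm
    rw [dif_neg hi.not_lt, hn]
    simp

theorem raisingCell_lie_jordanCell_zero (n : ℕ) :
    ⁅raisingCell n, jordanCell n 0⁆ = weightCell n := by
  rw [Ring.lie_def, raisingCell_mul_jordanCell_zero, jordanCell_zero_mul_raisingCell,
    Matrix.diagonal_sub, weightCell]
  congr 1
  ext i
  ring

theorem weightCell_lie_raisingCell (n : ℕ) :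
    ⁅weightCell n, raisingCell n⁆ = (2 : ℂ) • raisingCell n := by
  ext i j
  simp only [Ring.lie_def, weightCell, Matrix.sub_apply, Matrix.diagonal_mul, Matrix.mul_diagonal,
    Matrix.smul_apply, raisingCell, Matrix.of_apply, smul_eq_mul]
  split_ifs with h
  · rw [← h]
    push_cast
    ring
  · ring

theorem weightCell_lie_jordanCell_zero (n : ℕ) :
    ⁅weightCell n, jordanCell n 0⁆ = (-2 : ℂ) • jordanCell n 0 := by
  ext i j
  simp only [Ring.lie_def, weightCell, Matrix.sub_apply, Matrix.diagonal_mul, Matrix.mul_diagonal,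
    Matrix.smul_apply, jordanCell_zero_apply, smul_eq_mul]
  split_ifs with h
  · rw [← h]
    push_cast
    ring
  · ring

section KroneckerSum

variable {R m n : Type*} [CommRing R] [DecidableEq m] [DecidableEq n]

theorem kroneckerSum_smul (c : R) (A : Matrix m m R) (B : Matrix n n R) :
    kroneckerSum (c • A) (c • B) = c • kroneckerSum A B := by
  simp only [kroneckerSum, Matrix.smul_kronecker, Matrix.kronecker_smul, smul_add]

variable [Fintype m] [Fintype n]

theorem kroneckerSum_lie (A A' : Matrix m m R) (B B' : Matrix n n R) :
    ⁅kroneckerSum A B, kroneckerSum A' B'⁆ = kroneckerSum ⁅A, A'⁆ ⁅B, B'⁆ := by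
  simp only [kroneckerSum, Ring.lie_def, Matrix.add_mul, Matrix.mul_add,
    ← Matrix.mul_kronecker_mul, Matrix.mul_one, Matrix.one_mul]
  ext ⟨i, j⟩ ⟨i', j'⟩
  simp only [Matrix.add_apply, Matrix.sub_apply, Matrix.kronecker_apply]
  ring

theorem kroneckerSum_mulVec (A : Matrix m m R) (B : Matrix n n R) (g : m × n → R) (i : m)
    (j : n) :
    (kroneckerSum A B).mulVec g (i, j) =
      A.mulVec (fun i' => g (i', j)) i + B.mulVec (fun j' => g (i, j')) j := by
  simp [kroneckerSum, Matrix.mulVec, dotProduct, Fintype.sum_prod_type, add_mul,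
    Finset.sum_add_distrib, Matrix.one_apply]

end KroneckerSum

theorem isSl2Triple_kroneckerSum {p q : ℕ} (hp : 0 < p) (hq : 0 < q) (hpq : 2 < p + q) :
    IsSl2Triple (kroneckerSum (weightCell p) (weightCell q))
      (kroneckerSum (raisingCell p) (raisingCell q))
      (kroneckerSum (jordanCell p 0) (jordanCell q 0)) where
  h_ne_zero h := by
    have h₀ := congrFun₂ h (⟨0, hp⟩, ⟨0, hq⟩) (⟨0, hp⟩, ⟨0, hq⟩)
    simp only [kroneckerSum, weightCell, Matrix.add_apply, Matrix.kronecker_apply,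
      Matrix.diagonal_apply_eq, Matrix.one_apply_eq, Matrix.zero_apply, Nat.cast_zero] at h₀
    have h₂ : ((p + q : ℕ) : ℂ) = (2 : ℕ) := by
      push_cast
      linear_combination -h₀
    exact hpq.ne' (Nat.cast_injective h₂)
  lie_e_f := by
    rw [kroneckerSum_lie, raisingCell_lie_jordanCell_zero, raisingCell_lie_jordanCell_zero]
  lie_h_e_nsmul := by
    rw [kroneckerSum_lie, weightCell_lie_raisingCell, weightCell_lie_raisingCell,
      kroneckerSum_smul]
    module
  lie_h_f_nsmul := by
    rw [kroneckerSum_lie, weightCell_lie_jordanCell_zero, weightCell_lie_jordanCell_zero,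
      kroneckerSum_smul]
    module

/-- The coefficients `∏_{1 ≤ t ≤ i} t (n - t)` of the primitive vectors of a tensor product, up to
sign. Passing from `i - 1` to `i` multiplies by the entry `i (n - i)` of `raisingCell n`. -/
noncomputable def primitiveCoeff (n i : ℕ) : ℂ :=
  ∏ t ∈ Finset.range i, (((t + 1 : ℕ) : ℂ) * (n - (t + 1 : ℕ)))

theorem primitiveCoeff_succ (n i : ℕ) :
    primitiveCoeff n (i + 1) = ((i + 1 : ℕ) : ℂ) * (n - (i + 1 : ℕ)) * primitiveCoeff n i := by
  rw [primitiveCoeff, Finset.prod_range_succ, mul_comm, primitiveCoeff]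

theorem primitiveCoeff_ne_zero {n i : ℕ} (hi : i < n) : primitiveCoeff n i ≠ 0 := by
  refine Finset.prod_ne_zero_iff.2 fun t ht => mul_ne_zero (Nat.cast_ne_zero.2 t.succ_ne_zero) ?_
  have := Finset.mem_range.1 ht
  exact sub_ne_zero.2 (Nat.cast_injective.ne (by omega))

/-- The primitive vector of weight `p + q - 2 (k + 1)` in the tensor product of the irreducible
representations of `sl₂` of dimensions `p` and `q`. -/
noncomputable def primitiveVector (p q k : ℕ) : Fin p × Fin q → ℂ := fun x =>
  if (x.1 : ℕ) + x.2 + k + 2 = p + q then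
    (-1) ^ (x.1 : ℕ) * primitiveCoeff p x.1 * primitiveCoeff q x.2 else 0

theorem primitiveVector_ne_zero {p q k : ℕ} (hp : k < p) (hq : k < q) :
    primitiveVector p q k ≠ 0 := by
  have hcoeff : primitiveVector p q k (⟨p - 1, by omega⟩, ⟨q - 1 - k, by omega⟩) ≠ 0 := by
    rw [primitiveVector, if_pos (by grind)]
    exact mul_ne_zero (mul_ne_zero (pow_ne_zero _ (neg_ne_zero.2 one_ne_zero))
      (primitiveCoeff_ne_zero (Fin.is_lt _))) (primitiveCoeff_ne_zero (Fin.is_lt _))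
  exact fun h => hcoeff (congrFun h _)

theorem kroneckerSum_weightCell_mulVec_primitiveVector {p q k : ℕ} (hp : k < p) (hq : k < q) :
    (kroneckerSum (weightCell p) (weightCell q)).mulVec (primitiveVector p q k) =
      ((p + q - 2 * (k + 1) : ℕ) : ℂ) • primitiveVector p q k := by
  ext ⟨i, j⟩
  rw [kroneckerSum_mulVec, weightCell, Matrix.mulVec_diagonal, weightCell, Matrix.mulVec_diagonal,
    Pi.smul_apply, smul_eq_mul, ← add_mul]
  by_cases h : (i : ℕ) + j + k + 2 = p + q
  · have h' : (i : ℂ) + j + k + 2 = p + q := by exact_mod_cast h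
    rw [Nat.cast_sub (by omega)]
    push_cast
    linear_combination 2 * primitiveVector p q k (i, j) * h'
  · simp [primitiveVector, h]

theorem kroneckerSum_raisingCell_mulVec_primitiveVector {p q k : ℕ} (hp : k < p) (hq : k < q) :
    (kroneckerSum (raisingCell p) (raisingCell q)).mulVec (primitiveVector p q k) = 0 := by
  ext ⟨⟨i, hi⟩, ⟨j, hj⟩⟩
  rw [kroneckerSum_mulVec, raisingCell_mulVec, raisingCell_mulVec, Pi.zero_apply]
  by_cases h : i + j + k + 1 = p + q
  · obtain ⟨i, rfl⟩ := Nat.exists_eq_add_one_of_ne_zero (show i ≠ 0 by omega)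
    obtain ⟨j, rfl⟩ := Nat.exists_eq_add_one_of_ne_zero (show j ≠ 0 by omega)
    simp only [primitiveVector, Nat.succ_pos, if_true, Nat.add_sub_cancel]
    rw [if_pos (by omega), if_pos (by omega), primitiveCoeff_succ, primitiveCoeff_succ]
    ring
  · have hvanish : ∀ x : Fin p × Fin q, (x.1 : ℕ) + x.2 + 1 = i + j →
        primitiveVector p q k x = 0 := fun x hx => if_neg (by omega)
    have hleft : (if 0 < i then (i : ℂ) * (p - i) *
        primitiveVector p q k (⟨i - 1, by omega⟩, ⟨j, hj⟩) else 0) = 0 :=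
      ite_eq_right_iff.2 fun _ => by rw [hvanish _ (by grind), mul_zero]
    have hright : (if 0 < j then (j : ℂ) * (q - j) *
        primitiveVector p q k (⟨i, hi⟩, ⟨j - 1, by omega⟩) else 0) = 0 :=
      ite_eq_right_iff.2 fun _ => by rw [hvanish _ (by grind), mul_zero]
    exact (congrArg₂ (· + ·) hleft hright).trans (add_zero 0)

theorem sum_range_add_sub_two_mul_add_one {p q r : ℕ} (hp : r ≤ p) (hq : r ≤ q) :
    ∑ k ∈ Finset.range r, (p + q - 2 * (k + 1) + 1) = r * (p + q - r) := by
  induction r with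
  | zero => simp
  | succ r ih =>
    rw [Finset.sum_range_succ, ih (by omega) (by omega)]
    obtain ⟨s, rfl⟩ := Nat.exists_eq_add_of_le hp
    obtain ⟨t, rfl⟩ := Nat.exists_eq_add_of_le hq
    rw [show r + 1 + s + (r + 1 + t) - r = r + 2 + s + t by omega,
      show r + 1 + s + (r + 1 + t) - 2 * (r + 1) = s + t by omega,
      show r + 1 + s + (r + 1 + t) - (r + 1) = r + 1 + s + t by omega]
    ring

theorem sum_fin_min_add_sub_two_mul_add_one (p q : ℕ) :
    ∑ k : Fin (min p q), (p + q - 2 * ((k : ℕ) + 1) + 1) = p * q := by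
  rw [Fin.sum_univ_eq_sum_range fun k => p + q - 2 * (k + 1) + 1,
    sum_range_add_sub_two_mul_add_one (min_le_left p q) (min_le_right p q)]
  rcases le_total p q with h | h
  · rw [min_eq_left h, Nat.add_sub_cancel_left]
  · rw [min_eq_right h, Nat.add_sub_cancel, mul_comm]

theorem IsSimilar.kroneckerSum_jordanCell_zero (p q : ℕ) :
    IsSimilar (kroneckerSum (jordanCell p 0) (jordanCell q 0))
      (Matrix.blockDiagonal' fun k : Fin (min p q) =>
        jordanCell (p + q - 2 * ((k : ℕ) + 1) + 1) 0) := by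
  have hcard : ∑ k : Fin (min p q), (p + q - 2 * ((k : ℕ) + 1) + 1) =
      Fintype.card (Fin p × Fin q) := by
    rw [sum_fin_min_add_sub_two_mul_add_one, Fintype.card_prod, Fintype.card_fin, Fintype.card_fin]
  by_cases h : 0 < p ∧ 0 < q ∧ 2 < p + q
  · obtain ⟨hp, hq, hpq⟩ := h
    refine of_hasPrimitiveVectorWith (t := isSl2Triple_kroneckerSum hp hq hpq)
      (n := fun k : Fin (min p q) => p + q - 2 * ((k : ℕ) + 1))
      (fun k l hkl => Fin.ext (by grind)) (v := fun k => primitiveVector p q k) (fun k => ?_) hcard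
    obtain ⟨hkp, hkq⟩ := lt_min_iff.1 k.2
    exact ⟨primitiveVector_ne_zero hkp hkq, kroneckerSum_weightCell_mulVec_primitiveVector hkp hkq,
      kroneckerSum_raisingCell_mulVec_primitiveVector hkp hkq⟩
  · -- Here both sides vanish, whereas an `sl₂` triple is required to be nonzero.
    convert submatrix (kroneckerSum (jordanCell p 0) (jordanCell q 0))
      (Fintype.equivOfCardEq (α := Σ k : Fin (min p q), Fin (p + q - 2 * ((k : ℕ) + 1) + 1))
        (by simpa using hcard)) using 1
    have hzero : kroneckerSum (jordanCell p 0) (jordanCell q 0) = 0 := by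
      ext ⟨i, i'⟩ ⟨j, j'⟩
      have hp := i.pos
      have hq := i'.pos
      simp only [kroneckerSum, Matrix.add_apply, Matrix.kronecker_apply, jordanCell_zero_apply]
      rw [if_neg (by omega), if_neg (by omega)]
      simp
    ext x y
    rw [hzero, blockDiagonal'_jordanCell_zero_apply, if_neg (by grind)]
    rfl

end Sl2

/-! ### The product of two nilpotent cells -/

/-- The index set of the Jordan form of `J_p(0) ⊗ J_q(0)`: two cells of each size below
`min p q` and `|p - q| + 1` cells of size `min p q`. -/
abbrev DiagonalIndex (p q : ℕ) : Type :=
  (Σ k : Fin (min p q - 1), Fin ((k : ℕ) + 1) ⊕ Fin ((k : ℕ) + 1)) ⊕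
    (Σ _ : Fin (((p : ℤ) - (q : ℤ)).natAbs + 1), Fin (min p q))

/-- The position in the `p × q` rectangle of a vector of a Jordan chain of `J_p(0) ⊗ J_q(0)`. The
chains run along the diagonals: those of length `k + 1 < min p q` start in the first row or in the
first column, and the full ones are numbered by one of `p - q`, `q - p`, as the other one is `0`. -/
def diagonalPosition (p q : ℕ) : DiagonalIndex p q → Fin p × Fin q
  | Sum.inl ⟨k, Sum.inl s⟩ => (⟨s, by omega⟩, ⟨q - 1 - k + s, by omega⟩)
  | Sum.inl ⟨k, Sum.inr s⟩ => (⟨p - 1 - k + s, by omega⟩, ⟨s, by omega⟩)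
  | Sum.inr ⟨t, s⟩ => (⟨min (t : ℕ) (p - q) + s, by omega⟩, ⟨min (t : ℕ) (q - p) + s, by omega⟩)

theorem diagonalPosition_injective (p q : ℕ) : Function.Injective (diagonalPosition p q) := by
  rintro (⟨k, s | s⟩ | ⟨t, s⟩) (⟨k', s' | s'⟩ | ⟨t', s'⟩) h <;>
    simp only [diagonalPosition, Prod.mk.injEq, Fin.mk.injEq] at h
  case inl.inl.inl.inl =>
    obtain rfl : k = k' := by omega
    obtain rfl : s = s' := by omega
    rfl
  case inl.inr.inl.inr =>
    obtain rfl : k = k' := by omega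
    obtain rfl : s = s' := by omega
    rfl
  case inr.inr =>
    obtain rfl : t = t' := by omega
    obtain rfl : s = s' := by omega
    rfl
  all_goals omega

theorem card_diagonalIndex (p q : ℕ) : Fintype.card (DiagonalIndex p q) = p * q := by
  have hsum : ∀ r, ∑ k : Fin r, ((k : ℕ) + 1 + (k + 1)) = r * (r + 1) := fun r => by
    induction r with
    | zero => rfl
    | succ r ih =>
      rw [Fin.sum_univ_castSucc]
      simp only [Fin.val_castSucc, ih, Fin.val_last]
      ring
  have hcount : (min p q - 1) * (min p q - 1 + 1) + (((p : ℤ) - q).natAbs + 1) * min p q =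
      p * q := by
    rcases le_total p q with h | h <;> obtain ⟨d, rfl⟩ := Nat.exists_eq_add_of_le h
    · have hd : ((p : ℤ) - (p + d : ℕ)).natAbs = d := by omega
      rw [min_eq_left h, hd]
      cases p <;> grind
    · have hd : (((q + d : ℕ) : ℤ) - q).natAbs = d := by omega
      rw [min_eq_right h, hd]
      cases q <;> grind
  simpa [hsum] using hcount

theorem diagonalPosition_bijective (p q : ℕ) : Function.Bijective (diagonalPosition p q) :=
  (Fintype.bijective_iff_injective_and_card _).2
    ⟨diagonalPosition_injective p q, by simp [-Fintype.card_sum, card_diagonalIndex]⟩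

theorem jordanCell_zero_kronecker_jordanCell_zero_apply {p q : ℕ} (x y : Fin p × Fin q) :
    (jordanCell p 0 ⊗ₖ jordanCell q 0) x y =
      if (x.1 : ℕ) + 1 = y.1 ∧ (x.2 : ℕ) + 1 = y.2 then 1 else 0 := by
  simp [Matrix.kroneckerMap_apply, jordanCell_zero_apply, ← ite_and, and_comm]

theorem blockDiagonal'_matDirectSum {κ : Type*} [DecidableEq κ] {m n : κ → Type*}
    (C : ∀ k, Matrix (m k) (m k) ℂ) (D : ∀ k, Matrix (n k) (n k) ℂ) :
    Matrix.blockDiagonal' (fun k => matDirectSum (C k) (D k)) =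
      (matDirectSum (Matrix.blockDiagonal' C) (Matrix.blockDiagonal' D)).submatrix
        (Equiv.sigmaSumDistrib m n) (Equiv.sigmaSumDistrib m n) := by
  ext ⟨k, i⟩ ⟨l, j⟩
  rcases eq_or_ne k l with rfl | h
  · rcases i with i | i <;> rcases j with j | j <;> simp [matDirectSum]
  · rcases i with i | i <;> rcases j with j | j <;>
      simp [matDirectSum, Matrix.blockDiagonal'_apply_ne _ _ _ h]

theorem jordanCell_zero_kronecker_submatrix_diagonalPosition (p q : ℕ) :
    (jordanCell p 0 ⊗ₖ jordanCell q 0).submatrix (diagonalPosition p q) (diagonalPosition p q) =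
      matDirectSum
        (Matrix.blockDiagonal' fun k : Fin (min p q - 1) =>
          matDirectSum (jordanCell ((k : ℕ) + 1) 0) (jordanCell ((k : ℕ) + 1) 0))
        (Matrix.blockDiagonal' fun _ : Fin (((p : ℤ) - (q : ℤ)).natAbs + 1) =>
          jordanCell (min p q) 0) := by
  ext x y
  rw [Matrix.submatrix_apply, jordanCell_zero_kronecker_jordanCell_zero_apply]
  rw [blockDiagonal'_matDirectSum]
  rcases x with ⟨k, i | i⟩ | ⟨t, i⟩ <;> rcases y with ⟨l, j | j⟩ | ⟨u, j⟩ <;>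
    simp only [matDirectSum, Matrix.fromBlocks_apply₁₁, Matrix.fromBlocks_apply₁₂,
      Matrix.fromBlocks_apply₂₁, Matrix.fromBlocks_apply₂₂, Matrix.submatrix_apply,
      Equiv.sigmaSumDistrib_apply, Sum.map_inl, Sum.map_inr, Matrix.zero_apply, diagonalPosition,
      blockDiagonal'_jordanCell_zero_apply, Fin.ext_iff]
  case inl.inl.inl.inl => exact if_congr (by omega) rfl rfl
  case inl.inr.inl.inr => exact if_congr (by omega) rfl rfl
  case inr.inr => exact if_congr (by omega) rfl rfl
  all_goals exact if_neg (by omega)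

theorem IsSimilar.jordanCell_zero_kronecker_jordanCell_zero (p q : ℕ) :
    IsSimilar (jordanCell p 0 ⊗ₖ jordanCell q 0)
      (matDirectSum
        (Matrix.blockDiagonal' fun k : Fin (min p q - 1) =>
          matDirectSum (jordanCell ((k : ℕ) + 1) 0) (jordanCell ((k : ℕ) + 1) 0))
        (Matrix.blockDiagonal' fun _ : Fin (((p : ℤ) - (q : ℤ)).natAbs + 1) =>
          jordanCell (min p q) 0)) := by
  rw [← jordanCell_zero_kronecker_submatrix_diagonalPosition]
  exact submatrix _ (Equiv.ofBijective _ (diagonalPosition_bijective p q))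

theorem theorem4p10 (p q : ℕ) (hp : 0 < p) (hq : 0 < q) (a b : ℂ) :
    (a * b ≠ 0 →
      MatSimilar (tensorProductMap p q (jordanCell p a ⊗ₖ jordanCell q b))
        (Matrix.blockDiagonal' fun k : Fin (min p q) =>
          jordanCell (p + q - 2 * ((k : ℕ) + 1) + 1) (a * b))) ∧
    (a ≠ 0 →
      MatSimilar (tensorProductMap p q (jordanCell p a ⊗ₖ jordanCell q 0))
        (Matrix.blockDiagonal' fun _ : Fin p => jordanCell q 0)) ∧
    (b ≠ 0 →
      MatSimilar (tensorProductMap p q (jordanCell p 0 ⊗ₖ jordanCell q b))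
        (Matrix.blockDiagonal' fun _ : Fin q => jordanCell p 0)) ∧
    MatSimilar (tensorProductMap p q (jordanCell p 0 ⊗ₖ jordanCell q 0))
      (matDirectSum
        (Matrix.blockDiagonal' fun k : Fin (min p q - 1) =>
          matDirectSum (jordanCell ((k : ℕ) + 1) 0) (jordanCell ((k : ℕ) + 1) 0))
        (Matrix.blockDiagonal' fun _ : Fin (((p : ℤ) - (q : ℤ)).natAbs + 1) =>
          jordanCell (min p q) 0)) := by
  refine ⟨fun hab => ?_, fun ha => ?_, fun hb => ?_, ?_⟩ <;>
    apply IsSimilar.tensorProductMap_matSimilar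
  · obtain ⟨ha, hb⟩ := mul_ne_zero_iff.1 hab
    rw [blockDiagonal'_jordanCell]
    exact (IsSimilar.jordanCell_kronecker_jordanCell p q ha hb).trans
      ((IsSimilar.kroneckerSum_jordanCell_zero p q).smul_one_add (a * b))
  · exact IsSimilar.kronecker_jordanCell_zero q (isUnit_jordanCell p ha)
  · exact (IsSimilar.kronecker_comm _ _).trans
      (IsSimilar.kronecker_jordanCell_zero p (isUnit_jordanCell q hb))
  · exact IsSimilar.jordanCell_zero_kronecker_jordanCell_zero p q
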